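/- For $k\ge 1$, an instance $\mathcal R$ of the $k$-chain query $\mathcal Q_{\mathsf{chain}}=\pi_{A_1,A_{k+1}}\big(R_1(A_1,A_2)\Join R_2(A_2,A_3)\Join\cdots\Join R_k(A_k,A_{k+1})\big)$ consists of $k$ finite binary relations. Its input size is $N=\sum_i|R_i|$. Its result $\mathcal Q_{\mathsf{chain}}(\mathcal R)$ is the set of pairs $(v_1,v_{k+1})$ for which there are $v_2,\dots,v_k$ with $(v_i,v_{i+1})\in R_i$ for all $i$, and $\mathsf{OUT}=|\mathcal Q_{\mathsf{chain}}(\mathcal R)|$. Algorithms are randomized machines that access $\mathcal R$ through the primitives of the property testing model: draw a uniform tuple of $R_i$; for a tuple $t$ on a subset of the attributes of $R_i$, compute the number of tuples of $R_i$ that match $t$; access the $j$-th such tuple in a fixed (arbitrary) ordering of $R_i$; test whether a given tuple is in $R_i$. Each primitive, and each other operation on the configuration of the machine, takes one unit of time; nothing else is assumed about these operations, so the word RAM with random integers is included. A sampling algorithm first builds an index by preprocessing $\mathcal R$; every invocation of its sampler then starts from the index and from $\mathcal R$ with fresh randomness. It is $W$-uniform at an index if there is a number $W>0$ (which may depend on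 the index), $W\ge\mathsf{OUT}$, such that each invocation always returns the value $W$, returns a uniform sample from $\mathcal Q_{\mathsf{chain}}(\mathcal R)$ with probability $\mathsf{OUT}/W$ (so each result with probability $1/W$), and otherwise reports failure. The time for generating a sample is the expected total time of independent invocations until the first success, that is, $W/\mathsf{OUT}$ times the expected time of one invocation. **Theorem.** Let $k\ge 4$ and let $\gamma>0$ be a constant. No $W$-uniform sampling algorithm for $\mathcal Q_{\mathsf{chain}}$ can preprocess an instance of input size $N$ in $O(N^{1-\gamma})$ time and generate a sample in $O(N^{1-\gamma})$ time. More precisely, there are no sampling algorithm, real $C$ and integer $N_0$ such that for every instance $\mathcal R$ with $N\ge N_0$, with $\mathsf{OUT}\ge 1$ and with all values in $\{0,\dots,N-1\}$, the expected preprocessing time is at most $C\,N^{1-\gamma}$ and, with probability at least $2/3$ over the preprocessing, the algorithm is $W$-uniform at the index obtained and generates a sample from it in time at most $C\,N^{1-\gamma}$. -/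

import Mathlib

open scoped ENNReal

/-- A stored instance of the `k`-chain query
`π_{A₁, A_{k+1}} (R₁(A₁, A₂) ⋈ R₂(A₂, A₃) ⋈ ⋯ ⋈ R_k(A_k, A_{k+1}))`: each relation is a finite set
of pairs of values, stored as a list without repetitions. The order of the list is the fixed (but
arbitrary) ordering under which neighbors are accessed. -/
structure ChainInstance (k : ℕ) where
  rel : Fin k → List (ℕ × ℕ)
  nodup : ∀ i, (rel i).Nodup

namespace ChainInstance

variable {k : ℕ}

/-- The input size `N`: the total number of tuples. -/
def size (R : ChainInstance k) : ℕ := ∑ i, (R.rel i).length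

/-- The query result: the pairs `(v₁, v_{k+1})` of endpoints of the tuples `(v₁, …, v_{k+1})` of the
full join, without duplicates. -/
def result (R : ChainInstance k) : Set (ℕ × ℕ) :=
  {t | ∃ v : Fin (k + 1) → ℕ, (v 0, v (Fin.last k)) = t ∧
    ∀ i : Fin k, (v i.castSucc, v i.succ) ∈ R.rel i}

/-- The output size `OUT`. -/
noncomputable def out (R : ChainInstance k) : ℕ := R.result.ncard

/-- All values occurring in the instance lie in `{0, …, N - 1}`, so that a value fits in a word of
`⌈log₂ N⌉` bits. -/
def ValuesFit (R : ChainInstance k) : Prop :=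
  ∀ i, ∀ t ∈ R.rel i, t.1 < R.size ∧ t.2 < R.size

end ChainInstance

/-- A tuple defined on a subset of the two attributes of a relation (`none`: attribute absent). -/
abbrev PartialTuple : Type := Option ℕ × Option ℕ

/-- The tuple `t` agrees with the partial tuple `p` on the attributes of `p`. -/
def PartialTuple.Matches (p : PartialTuple) (t : ℕ × ℕ) : Prop :=
  (∀ a ∈ p.1, t.1 = a) ∧ (∀ b ∈ p.2, t.2 = b)

/-- The primitives of the property testing model. -/
inductive Primitive (k : ℕ) where
  | sampleTuple (i : Fin k)
  | computeDegree (i : Fin k) (p : PartialTuple)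
  | accessNeighbor (i : Fin k) (p : PartialTuple) (j : ℕ)
  | testTuple (i : Fin k) (t : ℕ × ℕ)

/-- What a primitive may return: a tuple (or the information that there is none), a number, or a
truth value. -/
inductive Answer where
  | tuple (t : Option (ℕ × ℕ))
  | number (n : ℕ)
  | truth (b : Bool)

namespace ChainInstance

variable {k : ℕ}

open Classical in
/-- The semi-join of `R_i` with a partial tuple, in the stored order. -/
noncomputable def semiJoin (R : ChainInstance k) (i : Fin k) (p : PartialTuple) : List (ℕ × ℕ) :=
  (R.rel i).filter fun t => p.Matches t

open Classical in
/-- The (random) answer to a primitive. Accessing the `j`-th neighbor of `p` returns the whole `j`-th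
tuple matching `p`, which consists of `p` and of its neighbor (`j` counts from `0`; there is no
answer if `j` is too large). There is no sample from an empty relation. -/
noncomputable def answer (R : ChainInstance k) : Primitive k → PMF Answer
  | .sampleTuple i =>
      if h : (R.rel i).toFinset.Nonempty then
        (PMF.uniformOfFinset (R.rel i).toFinset h).map fun t => .tuple (some t)
      else PMF.pure (.tuple none)
  | .computeDegree i p => PMF.pure (.number (R.semiJoin i p).length)
  | .accessNeighbor i p j => PMF.pure (.tuple (R.semiJoin i p)[j]?)
  | .testTuple i t => PMF.pure (.truth (decide (t ∈ R.rel i)))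

end ChainInstance

/-- What a machine does in a given configuration: halt with an output, perform one operation that
does not touch the instance (an arbitrary, possibly randomized, change of the configuration), or call
one primitive. -/
inductive MachineAction (k : ℕ) (State Output : Type) where
  | halt (o : Output)
  | compute (next : PMF State)
  | call (q : Primitive k) (next : Answer → State)

/-- A randomized machine with access to an instance through the primitives. Every step takes unit
time. Nothing is assumed about the configurations and the operations on them, so this comprises the
word RAM with random integers and with the primitives as unit-cost operations. -/
structure Machine (k : ℕ) (Input Output : Type) where
  State : Type
  start : Input → State
  action : State → MachineAction k State Output

namespace Machine

variable {k : ℕ} {Input Output : Type}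

/-- One step from a configuration; halting configurations stay where they are. -/
noncomputable def step (M : Machine k Input Output) (R : ChainInstance k) (s : M.State) :
    PMF M.State :=
  match M.action s with
  | .halt _ => PMF.pure s
  | .compute next => next
  | .call q next => (R.answer q).map next

/-- The distribution of the configuration after a number of steps. -/
noncomputable def run (M : Machine k Input Output) (R : ChainInstance k) (x : Input) :
    ℕ → PMF M.State
  | 0 => PMF.pure (M.start x)
  | n + 1 => (M.run R x n).bind (M.step R)

/-- The probability that the machine eventually halts with an output in `S` (the probability of
having done so after `n` steps increases with `n`). -/
noncomputable def prob (M : Machine k Input Output) (R : ChainInstance k) (x : Input)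
    (S : Set Output) : ℝ≥0∞ :=
  ⨆ n, (M.run R x n).toOuterMeasure {s | ∃ o ∈ S, M.action s = .halt o}

/-- The expected number of steps until the machine halts, as the sum over `n` of the probability of
not having halted after `n` steps. -/
noncomputable def expectedTime (M : Machine k Input Output) (R : ChainInstance k) (x : Input) :
    ℝ≥0∞ :=
  ∑' n, (M.run R x n).toOuterMeasure {s | ∀ o, M.action s ≠ .halt o}

end Machine

/-- A sampling algorithm: preprocessing builds an index, and every invocation of the sampler starts
from the index with fresh randomness. An invocation returns a tuple or reports failure (`none`), and
it always returns a number as well. -/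
structure SamplingAlgorithm (k : ℕ) where
  Index : Type
  preprocessing : Machine k Unit Index
  sampler : Machine k Index (Option (ℕ × ℕ) × ℝ)

namespace SamplingAlgorithm

variable {k : ℕ}

/-- From the index `I`, an invocation always returns the value `W`, it returns each tuple of the
query result with the same probability `1 / W` (so that it succeeds with probability `OUT / W`), and
it fails otherwise. -/
def IsWUniformAt (A : SamplingAlgorithm k) (R : ChainInstance k) (I : A.Index) (W : ℝ) : Prop :=
  0 < W ∧ (R.out : ℝ) ≤ W ∧
    (∀ t ∈ R.result, A.sampler.prob R I {(some t, W)} = ENNReal.ofReal (1 / W)) ∧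
    A.sampler.prob R I {(none, W)} = ENNReal.ofReal (1 - R.out / W)

/-- The expected time for generating a sample from the index `I` by independent invocations until the
first success: an invocation succeeds with probability `OUT / W`, so this is `W / OUT` times the
expected time of one invocation. -/
noncomputable def samplingTime (A : SamplingAlgorithm k) (R : ChainInstance k) (I : A.Index)
    (W : ℝ) : ℝ≥0∞ :=
  ENNReal.ofReal (W / R.out) * A.sampler.expectedTime R I

end SamplingAlgorithm

/-! The returned value `W` is an estimate of OUT: `W ≥ OUT` always, while `W / OUT` is at most the
sampling time once an invocation takes a step. A fast algorithm therefore separates instances whose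
output sizes differ by a factor `n`, and planting a single tuple can change OUT that much.

In the base instance (`j = n`), relation 0 leads `n` values to 0, relation 1 leads 0 to all `x < n`,
relation 2 sends these to the dead end `n`, which only continues to itself: OUT is at most `n`.
Planting `(0, n + j)` in place of `(0, j)` opens a route through 0, from which the last relation
fans out to `n` values: OUT is at least `n²`. A good value `W` on the base instance is below `n²`;
on a planted instance it is at least `n²`.

A hybrid argument shows that planting is hard to notice. A primitive with a deterministic answer
changes for at most one `j`, and a uniform tuple changes law by at most `1 / n` for each `j`, so one
step on the base instance has total distance at most 1 summed over `j` (`sum_gap_answer_le`). After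
`T` steps the sum is at most `T` (`sum_gap_run_le`), both for preprocessing and for the sampler from
any fixed index. Correctness makes each `j` contribute a constant (`one_le_gap_add_tsum`), so `n ≤
12 T`, which fails for `n = 24 T`. -/

/-! ### One-sided total variation distance -/

namespace PMF

variable {α β : Type*}

/-- The total variation distance of two probability mass functions, written one-sidedly. -/
noncomputable def gap (p q : PMF α) : ℝ≥0∞ := ∑' a, (p a - q a)

@[simp]
theorem gap_self (p : PMF α) : gap p p = 0 := by simp [gap]

theorem gap_le_one (p q : PMF α) : gap p q ≤ 1 :=
  (ENNReal.tsum_le_tsum fun _ => tsub_le_self).trans p.tsum_coe.le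

theorem toOuterMeasure_le_add_gap (p q : PMF α) (S : Set α) :
    p.toOuterMeasure S ≤ q.toOuterMeasure S + gap p q := by
  rw [toOuterMeasure_apply, toOuterMeasure_apply, gap, ← ENNReal.tsum_add]
  refine ENNReal.tsum_le_tsum fun a => ?_
  by_cases ha : a ∈ S
  · simpa [ha] using le_add_tsub
  · simp [ha]

theorem toOuterMeasure_add_compl (p : PMF α) (S : Set α) :
    p.toOuterMeasure S + p.toOuterMeasure Sᶜ = 1 := by
  rw [toOuterMeasure_apply, toOuterMeasure_apply, ← ENNReal.tsum_add, ← p.tsum_coe]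
  refine tsum_congr fun a => ?_
  by_cases ha : a ∈ S <;> simp [ha]

/-- The inner distances are weighted by `p` alone. With `p` the base run, they can be summed over
all planted instances under one common law. -/
theorem gap_bind_le (p q : PMF α) (f g : α → PMF β) :
    gap (p.bind f) (q.bind g) ≤ gap p q + ∑' a, p a * gap (f a) (g a) := by
  have key : ∀ b, (p.bind f) b - (q.bind g) b ≤
      ∑' a, ((p a - q a) * g a b + p a * (f a b - g a b)) := by
    intro b
    rw [tsub_le_iff_left, bind_apply, bind_apply, ← ENNReal.tsum_add]
    refine ENNReal.tsum_le_tsum fun a => ?_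
    calc p a * f a b ≤ p a * (g a b + (f a b - g a b)) := by gcongr; exact le_add_tsub
      _ = p a * g a b + p a * (f a b - g a b) := mul_add _ _ _
      _ ≤ (q a + (p a - q a)) * g a b + p a * (f a b - g a b) := by gcongr; exact le_add_tsub
      _ = _ := by ring
  refine (ENNReal.tsum_le_tsum key).trans_eq ?_
  rw [ENNReal.tsum_comm, gap, ← ENNReal.tsum_add]
  refine tsum_congr fun a => ?_
  rw [ENNReal.tsum_add, ENNReal.tsum_mul_left, ENNReal.tsum_mul_left, tsum_coe, mul_one, gap]

theorem gap_map_le (p q : PMF α) (f : α → β) : gap (p.map f) (q.map f) ≤ gap p q := by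
  simpa [PMF.map] using gap_bind_le p q (pure ∘ f) (pure ∘ f)

/-- Uniform distributions on sets of the same size, of which one contains all but one element of the
other. -/
theorem gap_uniformOfFinset_le [DecidableEq α] {s t : Finset α} (hs : s.Nonempty)
    (ht : t.Nonempty) (hcard : s.card = t.card) (a : α) (h : ∀ b ∈ s, b ≠ a → b ∈ t) :
    gap (uniformOfFinset s hs) (uniformOfFinset t ht) ≤ (s.card : ℝ≥0∞)⁻¹ := by
  have : ∀ b, uniformOfFinset s hs b - uniformOfFinset t ht b ≤
      if b = a then (s.card : ℝ≥0∞)⁻¹ else 0 := by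
    intro b
    rw [uniformOfFinset_apply, uniformOfFinset_apply, hcard]
    by_cases hb : b = a
    · rw [if_pos hb]
      split_ifs <;> simp
    · by_cases hbs : b ∈ s
      · simp [hbs, h b hbs hb, hb]
      · simp [hbs]
  exact (ENNReal.tsum_le_tsum this).trans_eq (tsum_ite_eq a _)

end PMF

/-! ### Halting probabilities and the hybrid argument -/

namespace Machine

variable {k : ℕ} {Input Output : Type} (M : Machine k Input Output) (R : ChainInstance k)
  (x : Input)

/-- The configurations in which the machine has halted with an output in `S`. -/
def haltedIn (S : Set Output) : Set M.State := {s | ∃ o ∈ S, M.action s = .halt o}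

/-- The configurations in which the machine has not halted. -/
def running : Set M.State := {s | ∀ o, M.action s ≠ .halt o}

theorem compl_running : M.runningᶜ = M.haltedIn Set.univ := by
  ext s
  simp [running, haltedIn]

theorem toOuterMeasure_haltedIn_mono (S : Set Output) :
    Monotone fun n => (M.run R x n).toOuterMeasure (M.haltedIn S) := by
  refine monotone_nat_of_le_succ fun n => ?_
  rw [run, PMF.toOuterMeasure_bind_apply, PMF.toOuterMeasure_apply]
  refine ENNReal.tsum_le_tsum fun s => ?_
  by_cases hs : s ∈ M.haltedIn S
  · obtain ⟨o, -, ho⟩ := id hs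
    simp [step, ho, hs]
  · simp [hs]

theorem toOuterMeasure_running_anti :
    Antitone fun n => (M.run R x n).toOuterMeasure M.running := by
  intro m n hmn
  have h := M.toOuterMeasure_haltedIn_mono R x Set.univ hmn
  have hm := (M.run R x m).toOuterMeasure_add_compl M.running
  have hn := (M.run R x n).toOuterMeasure_add_compl M.running
  rw [compl_running] at hm hn
  have hfin : (M.run R x n).toOuterMeasure (M.haltedIn Set.univ) ≠ ∞ :=
    ne_top_of_le_ne_top ENNReal.one_ne_top (hn ▸ le_add_self)
  refine (ENNReal.add_le_add_iff_right hfin).1 ?_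
  rw [hn, ← hm]
  gcongr

/-- Markov's inequality: the tail probabilities decrease, so each of the first `n` terms of the tail
sum is at least the `n`-th. -/
theorem mul_toOuterMeasure_running_le (n : ℕ) :
    n * (M.run R x n).toOuterMeasure M.running ≤ M.expectedTime R x := by
  refine le_trans ?_ (ENNReal.sum_le_tsum (Finset.range n))
  rw [← nsmul_eq_mul]
  have h := Finset.card_nsmul_le_sum (Finset.range n)
    (fun m => (M.run R x m).toOuterMeasure M.running) _
    fun m hm => M.toOuterMeasure_running_anti R x (Finset.mem_range.1 hm).le
  rwa [Finset.card_range] at h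

theorem haltedIn_compl_subset (S : Set Output) : M.haltedIn Sᶜ ⊆ (M.haltedIn S)ᶜ := by
  rintro s ⟨o, ho, h⟩ ⟨o', ho', h'⟩
  rw [h] at h'
  cases h'
  exact ho ho'

theorem toOuterMeasure_haltedIn_compl_add_prob_le (S : Set Output) (n : ℕ) :
    (M.run R x n).toOuterMeasure (M.haltedIn Sᶜ) + M.prob R x S ≤ 1 := by
  rw [prob, ENNReal.add_iSup]
  refine iSup_le fun m => ?_
  rw [← (M.run R x (max n m)).toOuterMeasure_add_compl (M.haltedIn S), add_comm]
  refine add_le_add (M.toOuterMeasure_haltedIn_mono R x S (le_max_right n m)) ?_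
  exact (M.toOuterMeasure_haltedIn_mono R x Sᶜ (le_max_left n m)).trans
    (MeasureTheory.measure_mono (M.haltedIn_compl_subset S))

theorem prob_mono {S S' : Set Output} (h : S ⊆ S') : M.prob R x S ≤ M.prob R x S' := by
  refine iSup_mono fun n => MeasureTheory.measure_mono ?_
  rintro s ⟨o, ho, hs⟩
  exact ⟨o, h ho, hs⟩

theorem prob_add_prob_le {S S' : Set Output} (h : Disjoint S S') :
    M.prob R x S + M.prob R x S' ≤ M.prob R x (S ∪ S') := by
  refine (ENNReal.iSup_add_iSup_of_monotone (M.toOuterMeasure_haltedIn_mono R x S)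
    (M.toOuterMeasure_haltedIn_mono R x S')).trans_le ?_
  refine iSup_mono fun n => ?_
  simp only [PMF.toOuterMeasure_apply]
  rw [← ENNReal.tsum_add]
  refine ENNReal.tsum_le_tsum fun s => ?_
  change (M.haltedIn S).indicator _ s + (M.haltedIn S').indicator _ s ≤
    (M.haltedIn (S ∪ S')).indicator _ s
  by_cases hs : s ∈ M.haltedIn S
  · have hs' : s ∉ M.haltedIn S' := by
      obtain ⟨o, ho, h1⟩ := hs
      rintro ⟨o', ho', h2⟩
      rw [h1] at h2
      cases h2
      exact Set.disjoint_left.1 h ho ho'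
    have hu : s ∈ M.haltedIn (S ∪ S') := by
      obtain ⟨o, ho, h1⟩ := hs
      exact ⟨o, Or.inl ho, h1⟩
    simp [hs, hs', hu]
  · by_cases hs' : s ∈ M.haltedIn S'
    · have hu : s ∈ M.haltedIn (S ∪ S') := by
        obtain ⟨o, ho, h1⟩ := hs'
        exact ⟨o, Or.inr ho, h1⟩
      simp [hs, hs', hu]
    · simp [hs, hs']

theorem sum_prob_singleton_le (F : Finset Output) :
    ∑ o ∈ F, M.prob R x {o} ≤ M.prob R x F := by
  classical
  induction F using Finset.induction_on with
  | empty => simp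
  | insert o F ho ih =>
    rw [Finset.sum_insert ho, Finset.coe_insert, Set.insert_eq]
    exact (add_le_add le_rfl ih).trans
      (M.prob_add_prob_le R x (Set.disjoint_singleton_left.2 (by simpa using ho)))

theorem run_eq_pure_of_halt {o : Output} (h : M.action (M.start x) = .halt o) (n : ℕ) :
    M.run R x n = PMF.pure (M.start x) := by
  induction n with
  | zero => rfl
  | succ n ih => simp [run, ih, step, h]

theorem one_le_expectedTime (h : M.start x ∈ M.running) : 1 ≤ M.expectedTime R x := by
  refine le_trans ?_ (ENNReal.le_tsum 0)
  have h' : ∀ o, M.action (M.start x) ≠ .halt o := h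
  simp [run, h']

/-- Hybrid argument: each step adds an average, over the run on `R`, of one-step distances whose sum
over `J` is at most 1 in every configuration. -/
theorem sum_gap_run_le {ι : Type*} (J : Finset ι) (R' : ι → ChainInstance k)
    (h : ∀ s, ∑ j ∈ J, PMF.gap (M.step R s) (M.step (R' j) s) ≤ 1) (n : ℕ) :
    ∑ j ∈ J, PMF.gap (M.run R x n) (M.run (R' j) x n) ≤ n := by
  induction n with
  | zero => simp [run]
  | succ n ih =>
    calc _ ≤ ∑ j ∈ J, (PMF.gap (M.run R x n) (M.run (R' j) x n) +
          ∑' s, M.run R x n s * PMF.gap (M.step R s) (M.step (R' j) s)) :=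
          Finset.sum_le_sum fun j _ => PMF.gap_bind_le _ _ _ _
      _ = ∑ j ∈ J, PMF.gap (M.run R x n) (M.run (R' j) x n) +
          ∑' s, M.run R x n s * ∑ j ∈ J, PMF.gap (M.step R s) (M.step (R' j) s) := by
          rw [Finset.sum_add_distrib, ← Summable.tsum_finsetSum fun _ _ => ENNReal.summable]
          simp_rw [Finset.mul_sum]
      _ ≤ n + ∑' s, M.run R x n s * 1 := by
          gcongr with s
          exact h s
      _ = (n + 1 : ℕ) := by simp [PMF.tsum_coe]

theorem sum_gap_step_le {ι : Type*} (J : Finset ι) (R' : ι → ChainInstance k)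
    (h : ∀ q, ∑ j ∈ J, PMF.gap (R.answer q) ((R' j).answer q) ≤ 1) (s : M.State) :
    ∑ j ∈ J, PMF.gap (M.step R s) (M.step (R' j) s) ≤ 1 := by
  unfold step
  cases M.action s with
  | halt o => simp
  | compute next => simp
  | call q next =>
    exact (Finset.sum_le_sum fun j _ => PMF.gap_map_le _ _ _).trans (h q)

end Machine

/-! ### The hard instances and their output sizes -/

/-- The relations of the hard instances, numbered from `0`. For `j < n` the tuple `(0, j)` of the
relation `1` is replaced by `(0, n + j)`. -/
def hardRel (n j : ℕ) : ℕ → List (ℕ × ℕ)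
  | 0 => (List.range n).map fun x => (x, 0)
  | 1 => (List.range n).map fun x => (0, if x = j then n + x else x)
  | 2 => (List.range (2 * n)).map fun x => (x, if x < n then n else 0)
  | _ + 3 => (List.range (n + 1)).map fun x => (if x < n then 0 else n, x)

theorem hardRel_nodup (n j m : ℕ) : (hardRel n j m).Nodup := by
  match m with
  | 0 => exact List.nodup_range.map fun a b h => by simpa using h
  | 1 =>
    refine List.Nodup.map_on ?_ List.nodup_range
    intro a ha b hb h
    simp only [List.mem_range] at ha hb
    simp only [Prod.mk.injEq, true_and] at h
    split_ifs at h <;> omega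
  | 2 => exact List.nodup_range.map fun a b h => (Prod.ext_iff.1 h).1
  | _ + 3 => exact List.nodup_range.map fun a b h => (Prod.ext_iff.1 h).2

/-- The hard instance in which the tuple `(0, j)` is replaced, if `j < n`. -/
def hardInstance (k n j : ℕ) : ChainInstance k where
  rel i := hardRel n j i
  nodup i := hardRel_nodup n j i

theorem length_hardRel (n j j' m : ℕ) : (hardRel n j m).length = (hardRel n j' m).length := by
  match m with
  | 0 | 1 | 2 | _ + 3 => simp [hardRel]

theorem length_hardRel_le {n : ℕ} (hn : 1 ≤ n) (j m : ℕ) : (hardRel n j m).length ≤ 2 * n := by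
  match m with
  | 0 | 1 | 2 | _ + 3 => simp [hardRel]; try omega

theorem hardRel_of_ne_one (n j j' : ℕ) {m : ℕ} (hm : m ≠ 1) : hardRel n j m = hardRel n j' m := by
  match m with
  | 0 | 2 | _ + 3 => rfl
  | 1 => exact absurd rfl hm

theorem size_hardInstance (k n j j' : ℕ) :
    (hardInstance k n j).size = (hardInstance k n j').size :=
  Finset.sum_congr rfl fun i _ => length_hardRel n j j' i

theorem size_hardInstance_le (k : ℕ) {n : ℕ} (hn : 1 ≤ n) (j : ℕ) :
    (hardInstance k n j).size ≤ k * (2 * n) := by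
  have h := Finset.sum_le_card_nsmul Finset.univ
    (fun i : Fin k => (hardRel n j i).length) (2 * n) fun i _ => length_hardRel_le hn j i
  simpa [ChainInstance.size, hardInstance] using h

theorem le_size_hardInstance {k : ℕ} (hk : 3 ≤ k) (n j : ℕ) :
    2 * n ≤ (hardInstance k n j).size := by
  have h := Finset.single_le_sum (f := fun i : Fin k => (hardRel n j i).length)
    (fun _ _ => Nat.zero_le _) (Finset.mem_univ ⟨2, hk⟩)
  rw [show (hardRel n j (⟨2, hk⟩ : Fin k)).length = 2 * n by simp [hardRel]] at h
  exact h

theorem valuesFit_hardInstance {k : ℕ} (hk : 3 ≤ k) {n : ℕ} (hn : 1 ≤ n) (j : ℕ) :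
    (hardInstance k n j).ValuesFit := by
  intro i t ht
  have hsize := le_size_hardInstance hk n j
  suffices h : ∀ m, ∀ t ∈ hardRel n j m, t.1 < 2 * n ∧ t.2 < 2 * n from
    ⟨(h i t ht).1.trans_le hsize, (h i t ht).2.trans_le hsize⟩
  intro m t ht
  match m with
  | 0 | 1 | 2 | _ + 3 =>
    simp only [hardRel, List.mem_map, List.mem_range] at ht
    obtain ⟨x, hx, rfl⟩ := ht
    dsimp only
    constructor <;> (try split_ifs) <;> omega

theorem mem_result_hardInstance {k n j : ℕ} {t : ℕ × ℕ} :
    t ∈ (hardInstance k n j).result ↔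
      ∃ v : ℕ → ℕ, (v 0, v k) = t ∧ ∀ m < k, (v m, v (m + 1)) ∈ hardRel n j m := by
  constructor
  · rintro ⟨v, hv, h⟩
    refine ⟨fun m => v (Fin.ofNat (k + 1) m), ?_, fun m hm => ?_⟩
    · rw [← hv]
      have h0 : Fin.ofNat (k + 1) 0 = 0 := rfl
      have hlast : Fin.ofNat (k + 1) k = Fin.last k := Fin.ext (Nat.mod_eq_of_lt (by omega))
      dsimp only
      rw [h0, hlast]
    · have h1 : Fin.ofNat (k + 1) m = (⟨m, hm⟩ : Fin k).castSucc :=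
        Fin.ext (Nat.mod_eq_of_lt (by omega))
      have h2 : Fin.ofNat (k + 1) (m + 1) = (⟨m, hm⟩ : Fin k).succ :=
        Fin.ext (Nat.mod_eq_of_lt (by omega))
      dsimp only
      rw [h1, h2]
      exact h ⟨m, hm⟩
  · rintro ⟨v, hv, h⟩
    exact ⟨fun i => v i, by simpa using hv, fun i => h i i.2⟩

theorem result_hardInstance_self_subset {k : ℕ} (hk : 4 ≤ k) (n : ℕ) :
    (hardInstance k n n).result ⊆ (Finset.range n ×ˢ {n} : Finset (ℕ × ℕ)) := by
  intro t ht
  obtain ⟨v, rfl, h⟩ := mem_result_hardInstance.1 ht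
  have h0 := h 0 (by omega)
  have h1 := h 1 (by omega)
  have h2 := h 2 (by omega)
  simp only [hardRel, List.mem_map, List.mem_range, Prod.mk.injEq, zero_add,
    Nat.reduceAdd] at h0 h1 h2
  obtain ⟨x, hx, hx0, hx1⟩ := h0
  obtain ⟨y, hy, hy1, hy2⟩ := h1
  obtain ⟨z, hz, hz1, hz2⟩ := h2
  have h3 : ∀ m, 3 ≤ m → m ≤ k → v m = n := by
    intro m hm
    induction m, hm using Nat.le_induction with
    | base =>
      intro _
      rw [if_neg (by omega)] at hy2
      rw [if_pos (by omega)] at hz2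
      exact hz2.symm
    | succ m hm ih =>
      intro hmk
      obtain ⟨l, rfl⟩ := Nat.exists_eq_add_of_le' hm
      have h4 := h (l + 3) (by omega)
      simp only [hardRel, List.mem_map, List.mem_range, Prod.mk.injEq] at h4
      obtain ⟨w, hw, hw1, hw2⟩ := h4
      rw [ih (by omega)] at hw1
      -- A tuple `(0, w)` with `w < n` would force `n = 0`; only `(n, n)` continues from `n`.
      split_ifs at hw1 <;> omega
  simp [h3 k (by omega) le_rfl, ← hx0, hx]

theorem out_hardInstance_self_le {k : ℕ} (hk : 4 ≤ k) (n : ℕ) :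
    (hardInstance k n n).out ≤ n := by
  have h := Set.ncard_le_ncard (result_hardInstance_self_subset hk n) (Finset.finite_toSet _)
  rw [Set.ncard_coe_finset] at h
  simpa [ChainInstance.out] using h

theorem mem_result_hardInstance_self {k : ℕ} (hk : 4 ≤ k) {n : ℕ} (hn : 1 ≤ n) :
    (0, n) ∈ (hardInstance k n n).result := by
  refine mem_result_hardInstance.2 ⟨fun m => if m < 3 then 0 else n, ?_, fun m hm => ?_⟩
  · simp
    omega
  · match m with
    | 0 | 2 => simp [hardRel]; try omega
    | 1 => exact List.mem_map.2 ⟨0, List.mem_range.2 hn, by simp; omega⟩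
    | l + 3 =>
      dsimp only
      rw [if_neg (by omega), if_neg (by omega)]
      exact List.mem_map.2 ⟨n, by simp, by simp⟩

theorem one_le_out_hardInstance_self {k : ℕ} (hk : 4 ≤ k) {n : ℕ} (hn : 1 ≤ n) :
    1 ≤ (hardInstance k n n).out :=
  (Set.ncard_pos ((Finset.finite_toSet _).subset (result_hardInstance_self_subset hk n))).2
    ⟨_, mem_result_hardInstance_self hk hn⟩

/-- `Set.ncard` is 0 on infinite sets, so a lower bound on OUT needs finiteness. -/
theorem finite_result_hardInstance {k : ℕ} (hk : 3 ≤ k) {n : ℕ} (hn : 1 ≤ n) (j : ℕ) :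
    (hardInstance k n j).result.Finite := by
  refine (Finset.finite_toSet (Finset.range (hardInstance k n j).size ×ˢ
    Finset.range (hardInstance k n j).size)).subset fun t ht => ?_
  obtain ⟨v, rfl, h⟩ := mem_result_hardInstance.1 ht
  have hfit := valuesFit_hardInstance hk hn j
  have h0 := hfit ⟨0, by omega⟩ _ (h 0 (by omega))
  have h1 := hfit ⟨k - 1, by omega⟩ _ (h (k - 1) (by omega))
  rw [Nat.sub_add_cancel (by omega)] at h1
  simp [h0.1, h1.2]

theorem sq_le_out_hardInstance {k : ℕ} (hk : 4 ≤ k) {n j : ℕ} (hj : j < n) :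
    n * n ≤ (hardInstance k n j).out := by
  have hsub : ((Finset.range n ×ˢ Finset.range n : Finset (ℕ × ℕ)) : Set (ℕ × ℕ)) ⊆
      (hardInstance k n j).result := by
    rintro ⟨x, y⟩ hxy
    simp only [Finset.coe_product, Finset.coe_range, Set.mem_prod, Set.mem_Iio] at hxy
    refine mem_result_hardInstance.2
      -- The path `x, 0, n + j, 0, …, 0, y` uses the planted tuple.
      ⟨fun m => if m = 0 then x else if m = 2 then n + j else if m = k then y else 0, ?_,
        fun m hm => ?_⟩
    · dsimp only
      rw [if_pos rfl, if_neg (by omega), if_neg (by omega), if_pos rfl]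
    · dsimp only
      match m with
      | 0 => simp [hardRel, hxy.1]; omega
      | 1 =>
        rw [if_neg (by omega), if_neg (by omega), if_neg (by omega), if_neg (by omega),
          if_pos rfl]
        exact List.mem_map.2 ⟨j, by simpa using hj, by simp⟩
      | 2 =>
        rw [if_neg (by omega), if_pos rfl, if_neg (by omega), if_neg (by omega), if_neg (by omega)]
        exact List.mem_map.2 ⟨n + j, by simp; omega, by simp⟩
      | l + 3 =>
        rw [if_neg (by omega), if_neg (by omega), if_neg (by omega), if_neg (by omega),
          if_neg (by omega)]
        refine List.mem_map.2 ⟨if l + 3 + 1 = k then y else 0, ?_, ?_⟩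
        · simp; split_ifs <;> omega
        · rw [if_pos (by split_ifs <;> omega)]
  have h := Set.ncard_le_ncard hsub (finite_result_hardInstance (by omega) (by omega) j)
  rw [Set.ncard_coe_finset] at h
  simpa [ChainInstance.out] using h

/-! ### One primitive notices few plantings -/

theorem sum_le_one_of_eq_zero {J : Finset ℕ} {f : ℕ → ℝ≥0∞} (a : ℕ) (hf : ∀ j, f j ≤ 1)
    (h : ∀ j ∈ J, j ≠ a → f j = 0) : ∑ j ∈ J, f j ≤ 1 :=
  calc ∑ j ∈ J, f j ≤ ∑ j ∈ J, if j = a then 1 else 0 := by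
        refine Finset.sum_le_sum fun j hj => ?_
        split_ifs with hja
        · exact hf j
        · exact (h j hj hja).le
    _ ≤ 1 := by
        rw [Finset.sum_ite_eq']
        split_ifs <;> simp

/-- All first coordinates are 0, so a condition on the first attribute alone selects everything or
nothing. Degrees then do not depend on `j`. -/
theorem semiJoin_hardInstance_none {k : ℕ} (n j : ℕ) {i : Fin k} (hi : (i : ℕ) = 1)
    (a : Option ℕ) [Decidable (∀ b ∈ a, 0 = b)] :
    (hardInstance k n j).semiJoin i (a, none) =
      if ∀ b ∈ a, 0 = b then hardRel n j 1 else [] := by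
  unfold ChainInstance.semiJoin
  have hrel : (hardInstance k n j).rel i = hardRel n j 1 := by rw [← hi]; rfl
  rw [hrel]
  have hfst : ∀ t ∈ hardRel n j 1, t.1 = 0 := by
    intro t ht
    obtain ⟨x, -, rfl⟩ := List.mem_map.1 ht
    rfl
  split_ifs with h
  · refine List.filter_eq_self.2 fun t ht => ?_
    simpa [PartialTuple.Matches, hfst t ht] using h
  · refine List.filter_eq_nil_iff.2 fun t ht => ?_
    simpa [PartialTuple.Matches, hfst t ht] using h

theorem semiJoin_hardInstance_some {k n j v : ℕ} {i : Fin k} (hi : (i : ℕ) = 1) (hj : v ≠ j)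
    (hnj : v ≠ n + j) (a : Option ℕ) :
    (hardInstance k n n).semiJoin i (a, some v) = (hardInstance k n j).semiJoin i (a, some v) := by
  classical
  unfold ChainInstance.semiJoin
  have hrel : ∀ j', (hardInstance k n j').rel i = hardRel n j' 1 := by
    intro j'
    rw [← hi]
    rfl
  rw [hrel, hrel, hardRel, hardRel, List.filter_map, List.filter_map]
  have hfilter : (List.range n).filter ((fun t : ℕ × ℕ => decide
        (PartialTuple.Matches (a, some v) t)) ∘ fun x => (0, if x = n then n + x else x)) =
      (List.range n).filter ((fun t : ℕ × ℕ => decide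
        (PartialTuple.Matches (a, some v) t)) ∘ fun x => (0, if x = j then n + x else x)) := by
    refine List.filter_congr fun x hx => ?_
    have hx' : x ≠ n := (List.mem_range.1 hx).ne
    by_cases hxj : x = j
    · subst hxj
      simp [PartialTuple.Matches, hx', hj.symm, hnj.symm]
    · simp [hx', hxj]
  rw [hfilter]
  refine List.map_congr_left fun x hx => ?_
  obtain ⟨hx, hm⟩ := List.mem_filter.1 hx
  have hxj : x ≠ j := by
    rintro rfl
    simp [PartialTuple.Matches, hnj.symm] at hm
  rw [if_neg (List.mem_range.1 hx).ne, if_neg hxj]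

theorem mem_rel_iff_mem_semiJoin {k : ℕ} (R : ChainInstance k) (i : Fin k) (t : ℕ × ℕ) :
    t ∈ R.rel i ↔ t ∈ R.semiJoin i (none, some t.2) := by
  simp [ChainInstance.semiJoin, PartialTuple.Matches]

/-- The replacement happens in place, so it is visible only at position `j` of the ordering. -/
theorem getElem?_hardRel {n j l : ℕ} (hl : j ≠ l) :
    (hardRel n n 1)[l]? = (hardRel n j 1)[l]? := by
  simp only [hardRel, List.getElem?_map]
  by_cases h : l < n
  · rw [List.getElem?_range h]
    simp [h.ne, hl.symm]
  · simp [List.getElem?_eq_none (l := List.range n) (by simpa using h)]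

theorem gap_answer_sampleTuple_le {k n j : ℕ} (hj : j < n) {i : Fin k} (hi : (i : ℕ) = 1) :
    PMF.gap ((hardInstance k n n).answer (.sampleTuple i))
      ((hardInstance k n j).answer (.sampleTuple i)) ≤ (n : ℝ≥0∞)⁻¹ := by
  have hcard : ∀ j', ((hardInstance k n j').rel i).toFinset.card = n := by
    intro j'
    rw [List.toFinset_card_of_nodup ((hardInstance k n j').nodup i)]
    change (hardRel n j' i).length = n
    simp [hi, hardRel]
  have hne : ∀ j', ((hardInstance k n j').rel i).toFinset.Nonempty := by
    intro j'
    rw [← Finset.card_pos, hcard]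
    omega
  rw [ChainInstance.answer, ChainInstance.answer, dif_pos (hne n), dif_pos (hne j)]
  refine (PMF.gap_map_le _ _ _).trans ((PMF.gap_uniformOfFinset_le (hne n) (hne j)
    ((hcard n).trans (hcard j).symm) (0, j) ?_).trans_eq (by rw [hcard]))
  intro b hb hbj
  rw [List.mem_toFinset] at hb ⊢
  change b ∈ hardRel n n i at hb
  change b ∈ hardRel n j i
  rw [hi] at hb ⊢
  obtain ⟨x, hx, rfl⟩ := List.mem_map.1 hb
  have hx' : x ≠ n := (List.mem_range.1 hx).ne
  refine List.mem_map.2 ⟨x, hx, ?_⟩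
  rw [if_neg hx'] at hbj ⊢
  rw [if_neg fun h => hbj (by rw [h])]

theorem sum_gap_answer_le (k n : ℕ) (q : Primitive k) :
    ∑ j ∈ Finset.range n,
      PMF.gap ((hardInstance k n n).answer q) ((hardInstance k n j).answer q) ≤ 1 := by
  classical
  have hother : ∀ (i : Fin k) (j : ℕ), (i : ℕ) ≠ 1 →
      (hardInstance k n n).rel i = (hardInstance k n j).rel i :=
    fun i j hi => hardRel_of_ne_one n n j hi
  have hsemi : ∀ (i : Fin k) (j : ℕ) p, (i : ℕ) ≠ 1 →
      (hardInstance k n n).semiJoin i p = (hardInstance k n j).semiJoin i p := by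
    intro i j p hi
    rw [ChainInstance.semiJoin, ChainInstance.semiJoin, hother i j hi]
  -- The exceptional value is the only candidate `j < n` with `v = j` or `v = n + j`.
  have hsome : ∀ (i : Fin k) (a : Option ℕ) (v j : ℕ), (i : ℕ) = 1 → j ∈ Finset.range n →
      (j ≠ if v < n then v else v - n) →
      (hardInstance k n n).semiJoin i (a, some v) =
        (hardInstance k n j).semiJoin i (a, some v) := by
    intro i a v j hi hj hjv
    rw [Finset.mem_range] at hj
    refine semiJoin_hardInstance_some hi ?_ ?_ a <;> split_ifs at hjv <;> omega
  have hle := fun j => PMF.gap_le_one ((hardInstance k n n).answer q)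
    ((hardInstance k n j).answer q)
  match q with
  | .sampleTuple i =>
    by_cases hi : (i : ℕ) = 1
    · refine (Finset.sum_le_sum fun j hj =>
        gap_answer_sampleTuple_le (Finset.mem_range.1 hj) hi).trans ?_
      rw [Finset.sum_const, Finset.card_range, nsmul_eq_mul]
      exact ENNReal.mul_inv_le_one _
    · refine sum_le_one_of_eq_zero 0 hle fun j _ _ => ?_
      simp only [ChainInstance.answer, hother i j hi, PMF.gap_self]
  | .computeDegree i p =>
    by_cases hi : (i : ℕ) = 1
    · match p with
      | (a, none) =>
        refine sum_le_one_of_eq_zero 0 hle fun j _ _ => ?_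
        have hlen : ((hardInstance k n n).semiJoin i (a, none)).length =
            ((hardInstance k n j).semiJoin i (a, none)).length := by
          rw [semiJoin_hardInstance_none n n hi, semiJoin_hardInstance_none n j hi]
          split_ifs
          · exact length_hardRel n n j 1
          · rfl
        simp only [ChainInstance.answer, hlen, PMF.gap_self]
      | (a, some v) =>
        refine sum_le_one_of_eq_zero (if v < n then v else v - n) hle fun j hj hjv => ?_
        simp only [ChainInstance.answer, hsome i a v j hi hj hjv, PMF.gap_self]
    · refine sum_le_one_of_eq_zero 0 hle fun j _ _ => ?_
      simp only [ChainInstance.answer, hsemi i j p hi, PMF.gap_self]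
  | .accessNeighbor i p l =>
    by_cases hi : (i : ℕ) = 1
    · match p with
      | (a, none) =>
        refine sum_le_one_of_eq_zero l hle fun j _ hjl => ?_
        have hget : ((hardInstance k n n).semiJoin i (a, none))[l]? =
            ((hardInstance k n j).semiJoin i (a, none))[l]? := by
          rw [semiJoin_hardInstance_none n n hi, semiJoin_hardInstance_none n j hi]
          split_ifs
          · exact getElem?_hardRel hjl
          · rfl
        simp only [ChainInstance.answer, hget, PMF.gap_self]
      | (a, some v) =>
        refine sum_le_one_of_eq_zero (if v < n then v else v - n) hle fun j hj hjv => ?_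
        simp only [ChainInstance.answer, hsome i a v j hi hj hjv, PMF.gap_self]
    · refine sum_le_one_of_eq_zero 0 hle fun j _ _ => ?_
      simp only [ChainInstance.answer, hsemi i j p hi, PMF.gap_self]
  | .testTuple i t =>
    refine sum_le_one_of_eq_zero (if t.2 < n then t.2 else t.2 - n) hle fun j hj hjv => ?_
    have hmem : (hardInstance k n n).semiJoin i (none, some t.2) =
        (hardInstance k n j).semiJoin i (none, some t.2) := by
      by_cases hi : (i : ℕ) = 1
      · exact hsome i none t.2 j hi hj hjv
      · exact hsemi i j _ hi
    simp only [ChainInstance.answer, mem_rel_iff_mem_semiJoin, hmem, PMF.gap_self]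

/-! ### Consequences of uniformity -/

namespace SamplingAlgorithm

variable {k : ℕ} {A : SamplingAlgorithm k} {R : ChainInstance k} {I : A.Index} {W : ℝ}

/-- The OUT successes of probability `1 / W` and the failure already have total mass 1. -/
theorem IsWUniformAt.one_le_prob (h : A.IsWUniformAt R I W) (hout : 1 ≤ R.out) :
    1 ≤ A.sampler.prob R I {o | o.2 = W} := by
  classical
  obtain ⟨hW, hle, hsucc, hfail⟩ := h
  have hfin : R.result.Finite := Set.finite_of_ncard_pos hout
  have hcard : hfin.toFinset.card = R.out := (Set.ncard_eq_toFinset_card _ hfin).symm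
  let F : Finset (Option (ℕ × ℕ)) := insert none (hfin.toFinset.image some)
  have hsum : ∑ o ∈ F.image (fun t => (t, W)), A.sampler.prob R I {o} = 1 := by
    rw [Finset.sum_image (by simp), Finset.sum_insert (by simp), hfail,
      Finset.sum_image (by simp), Finset.sum_congr rfl fun t ht => hsucc t (by simpa using ht),
      Finset.sum_const, hcard, nsmul_eq_mul, ← ENNReal.ofReal_natCast,
      ← ENNReal.ofReal_mul (by positivity),
      ← ENNReal.ofReal_add (sub_nonneg.2 ((div_le_one hW).2 hle)) (by positivity)]
    simp [div_eq_mul_inv]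
  rw [← hsum]
  refine (A.sampler.sum_prob_singleton_le R I _).trans (A.sampler.prob_mono R I ?_)
  intro o ho
  obtain ⟨t, -, rfl⟩ := Finset.mem_image.1 (Finset.mem_coe.1 ho)
  rfl

theorem IsWUniformAt.toOuterMeasure_haltedIn_eq_zero (h : A.IsWUniformAt R I W)
    (hout : 1 ≤ R.out) (n : ℕ) :
    (A.sampler.run R I n).toOuterMeasure (A.sampler.haltedIn {o | o.2 = W}ᶜ) = 0 := by
  have h1 := A.sampler.toOuterMeasure_haltedIn_compl_add_prob_le R I {o | o.2 = W} n
  have h2 := (add_le_add le_rfl (h.one_le_prob hout)).trans h1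
  simpa using ENNReal.le_sub_of_add_le_right ENNReal.one_ne_top h2

/-- Halting at once gives every outcome probability 0 or 1, but a result must have probability `1 /
W`, strictly in between. This excludes invocations of cost zero, for which a large `W / OUT` would
be free. -/
theorem IsWUniformAt.start_mem_running (h : A.IsWUniformAt R I W) (hout : 1 ≤ R.out)
    (hW : 1 < W) : A.sampler.start I ∈ A.sampler.running := by
  intro o ho
  obtain ⟨t, ht⟩ := Set.nonempty_of_ncard_ne_zero (Nat.one_le_iff_ne_zero.1 hout)
  have hp := h.2.2.1 t ht
  have hpos : 0 < ENNReal.ofReal (1 / W) := ENNReal.ofReal_pos.2 (one_div_pos.2 h.1)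
  have hlt : ENNReal.ofReal (1 / W) < 1 :=
    ENNReal.ofReal_lt_one.2 ((div_lt_one h.1).2 hW)
  rw [← hp, Machine.prob] at hpos hlt
  simp only [A.sampler.run_eq_pure_of_halt R I ho, iSup_const, PMF.toOuterMeasure_pure_apply]
    at hpos hlt
  split_ifs at hpos hlt <;> simp_all

theorem IsWUniformAt.expectedTime_le (h : A.IsWUniformAt R I W) (hout : 1 ≤ R.out) :
    A.sampler.expectedTime R I ≤ A.samplingTime R I W := by
  refine le_mul_of_one_le_left' ?_
  rw [← ENNReal.ofReal_one]
  exact ENNReal.ofReal_le_ofReal ((one_le_div (by exact_mod_cast hout)).2 h.2.1)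

/-- The indices at which the algorithm is uniform and generates a sample in expected time `B`. -/
def goodIndices (A : SamplingAlgorithm k) (R : ChainInstance k) (B : ℝ≥0∞) : Set A.Index :=
  {I | ∃ W : ℝ, A.IsWUniformAt R I W ∧ A.samplingTime R I W ≤ B}

end SamplingAlgorithm

/-! ### Correct algorithms distinguish the hard instances -/

theorem ENNReal.twelve_mul_le_one_of_mul_le {T B P : ℝ≥0∞} (hT : T ≠ 0) (hT' : T ≠ ∞)
    (h : T * P ≤ B) (hB : 12 * B ≤ T) : 12 * P ≤ 1 := by
  have h1 : T * (12 * P) ≤ T * 1 :=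
    calc T * (12 * P) = 12 * (T * P) := by ring
      _ ≤ 12 * B := by gcongr
      _ ≤ T * 1 := by rwa [mul_one]
  exact (ENNReal.mul_le_mul_iff_right hT hT').1 h1

/-- After `T` steps the base run has mostly halted, and then with value `W`; the planted run never
halts with a value other than `W'`. As `W ≠ W'`, the two laws are far apart. Only the base instance
needs the time bound. -/
theorem one_le_two_mul_gap_of_mem_goodIndices {k : ℕ} (hk : 4 ≤ k) {A : SamplingAlgorithm k}
    {n j T : ℕ} (hj : j < n) (hT : T ≠ 0) (hTn : T < n) {B : ℝ≥0∞} (hB : 12 * B ≤ T)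
    {I : A.Index} (h : I ∈ A.goodIndices (hardInstance k n n) B)
    (h' : I ∈ A.goodIndices (hardInstance k n j) B) :
    1 ≤ 2 * PMF.gap (A.sampler.run (hardInstance k n n) I T)
      (A.sampler.run (hardInstance k n j) I T) := by
  obtain ⟨W, hW, hWB⟩ := h
  obtain ⟨W', hW', -⟩ := h'
  have hout := one_le_out_hardInstance_self hk (n := n) (by omega)
  have hsq := sq_le_out_hardInstance hk hj
  have hout' : 1 ≤ (hardInstance k n j).out := le_trans (by nlinarith) hsq
  have hrun := ENNReal.twelve_mul_le_one_of_mul_le (by exact_mod_cast hT)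
    (ENNReal.natCast_ne_top T) ((A.sampler.mul_toOuterMeasure_running_le _ I T).trans
      ((hW.expectedTime_le hout).trans hWB)) hB
  -- A common value would be at least `n²`, so the sampling time on the base instance would be at
  -- least `n² / n = n > T`.
  have hWW : W ≠ W' := by
    rintro rfl
    have hn : (2 : ℝ) ≤ n := by
      have : 2 ≤ n := by omega
      exact_mod_cast this
    have hWn : (n : ℝ) * n ≤ W := le_trans (by exact_mod_cast hsq) hW'.2.1
    have hstart := A.sampler.one_le_expectedTime (hardInstance k n n) I
      (hW.start_mem_running hout (by nlinarith))
    have hratio : (n : ℝ) ≤ W / (hardInstance k n n).out := by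
      rw [le_div_iff₀ (by exact_mod_cast hout)]
      refine le_trans ?_ hWn
      gcongr
      exact out_hardInstance_self_le hk n
    have hnB : (n : ℝ≥0∞) ≤ B :=
      calc (n : ℝ≥0∞) = ENNReal.ofReal n * 1 := by simp
        _ ≤ A.samplingTime (hardInstance k n n) I W :=
          mul_le_mul' (ENNReal.ofReal_le_ofReal hratio) hstart
        _ ≤ B := hWB
    have hnT : (12 : ℝ≥0∞) * n ≤ T := le_trans (by gcongr) hB
    have hnT' : 12 * n ≤ T := by exact_mod_cast hnT
    omega
  have hcover : (Set.univ : Set A.sampler.State) ⊆ A.sampler.running ∪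
      (A.sampler.haltedIn {o | o.2 = W}ᶜ ∪ A.sampler.haltedIn {o | o.2 = W'}ᶜ) := by
    intro s _
    by_cases hs : s ∈ A.sampler.running
    · exact Or.inl hs
    · obtain ⟨o, ho⟩ := not_forall_not.1 hs
      by_cases hoW : o.2 = W
      · exact Or.inr (Or.inr ⟨o, fun h => hWW (hoW.symm.trans h), ho⟩)
      · exact Or.inr (Or.inl ⟨o, hoW, ho⟩)
  set p := A.sampler.run (hardInstance k n n) I T
  set g := PMF.gap p (A.sampler.run (hardInstance k n j) I T)
  have hle : 1 ≤ p.toOuterMeasure A.sampler.running + g :=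
    calc (1 : ℝ≥0∞) = p.toOuterMeasure Set.univ := by
          simpa using (p.toOuterMeasure_add_compl Set.univ).symm
      _ ≤ p.toOuterMeasure A.sampler.running +
          (p.toOuterMeasure (A.sampler.haltedIn {o | o.2 = W}ᶜ) +
            p.toOuterMeasure (A.sampler.haltedIn {o | o.2 = W'}ᶜ)) :=
          (MeasureTheory.measure_mono hcover).trans ((MeasureTheory.measure_union_le _ _).trans
            (by gcongr; exact MeasureTheory.measure_union_le _ _))
      _ ≤ p.toOuterMeasure A.sampler.running + (0 + (0 + g)) := by
          gcongr
          · exact (hW.toOuterMeasure_haltedIn_eq_zero hout T).le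
          · refine (PMF.toOuterMeasure_le_add_gap p
              (A.sampler.run (hardInstance k n j) I T) _).trans ?_
            rw [hW'.toOuterMeasure_haltedIn_eq_zero hout' T]
      _ = _ := by simp
  generalize p.toOuterMeasure A.sampler.running = P at hle hrun
  have hg : g ≠ ∞ := ne_top_of_le_ne_top ENNReal.one_ne_top (PMF.gap_le_one _ _)
  have hP : P ≠ ∞ := by
    rintro rfl
    simp at hrun
  clear_value g
  lift g to NNReal using hg
  lift P to NNReal using hP
  norm_cast at hle hrun ⊢
  rw [← NNReal.coe_le_coe] at hle hrun ⊢
  push_cast at hle hrun ⊢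
  linarith

namespace SamplingAlgorithm

variable {k : ℕ} (A : SamplingAlgorithm k)

/-- The distance of the samplers on two instances after `T` steps, started from the index which
preprocessing has produced. -/
noncomputable def samplerGap (R R' : ChainInstance k) (T : ℕ) (s : A.preprocessing.State) :
    ℝ≥0∞ :=
  match A.preprocessing.action s with
  | .halt I => PMF.gap (A.sampler.run R I T) (A.sampler.run R' I T)
  -- Unfinished preprocessing is accounted for separately, by its small probability.
  | _ => 0

theorem sum_samplerGap_le (n T : ℕ) (s : A.preprocessing.State) :
    ∑ j ∈ Finset.range n, A.samplerGap (hardInstance k n n) (hardInstance k n j) T s ≤ T := by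
  unfold samplerGap
  cases A.preprocessing.action s with
  | halt I =>
    exact A.sampler.sum_gap_run_le _ I (Finset.range n) (hardInstance k n)
      (A.sampler.sum_gap_step_le _ _ _ (sum_gap_answer_le k n)) T
  | _ => simp

end SamplingAlgorithm

/-- Preprocessing on the base instance either is unfinished, or yields an index bad for the base
instance, or one bad for instance `j` (a probability transferred from the planted run at the cost of
the gap), or one good for both, where the samplers are at distance at least `1 / 2`. -/
theorem one_le_gap_add_tsum {k : ℕ} (hk : 4 ≤ k) (A : SamplingAlgorithm k) {n j T : ℕ}
    (hj : j < n) (hT : T ≠ 0) (hTn : T < n) {B : ℝ≥0∞} (hB : 12 * B ≤ T)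
    (hpre : A.preprocessing.expectedTime (hardInstance k n n) () ≤ B)
    (h : 2 / 3 ≤ A.preprocessing.prob (hardInstance k n n) ()
      (A.goodIndices (hardInstance k n n) B))
    (h' : 2 / 3 ≤ A.preprocessing.prob (hardInstance k n j) ()
      (A.goodIndices (hardInstance k n j) B)) :
    1 ≤ 4 * PMF.gap (A.preprocessing.run (hardInstance k n n) () T)
        (A.preprocessing.run (hardInstance k n j) () T) +
      8 * ∑' s, A.preprocessing.run (hardInstance k n n) () T s *
        A.samplerGap (hardInstance k n n) (hardInstance k n j) T s := by
  set M := A.preprocessing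
  set p := M.run (hardInstance k n n) () T
  set q := M.run (hardInstance k n j) () T
  set G := A.goodIndices (hardInstance k n n) B
  set G' := A.goodIndices (hardInstance k n j) B
  set d : M.State → ℝ≥0∞ := A.samplerGap (hardInstance k n n) (hardInstance k n j) T
  have hrun := ENNReal.twelve_mul_le_one_of_mul_le (by exact_mod_cast hT)
    (ENNReal.natCast_ne_top T) ((M.mul_toOuterMeasure_running_le _ () T).trans hpre) hB
  have hthird : ∀ x y : ℝ≥0∞, x + y ≤ 1 → 2 / 3 ≤ y → 3 * x ≤ 1 := by
    intro x y hxy hy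
    have hle : x + 2 / 3 ≤ 1 := (by gcongr : x + 2 / 3 ≤ x + y).trans hxy
    have hle' : 3 * x + 2 ≤ 1 + 2 :=
      calc 3 * x + 2 = 3 * (x + 2 / 3) := by
            rw [mul_add, ENNReal.mul_div_cancel (by simp) (by simp)]
        _ ≤ 3 * 1 := by gcongr
        _ = 1 + 2 := by norm_num
    exact (ENNReal.add_le_add_iff_right (by simp)).1 hle'
  have h1 := hthird _ _ (M.toOuterMeasure_haltedIn_compl_add_prob_le _ () G T) h
  have h2 := hthird _ _ (M.toOuterMeasure_haltedIn_compl_add_prob_le _ () G' T) h'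
  have h3 := PMF.toOuterMeasure_le_add_gap p q (M.haltedIn G'ᶜ)
  have hpoint : ∀ s, p s ≤ (M.running.indicator p s + (M.haltedIn Gᶜ).indicator p s) +
      ((M.haltedIn G'ᶜ).indicator p s + 2 * (p s * d s)) := by
    intro s
    by_cases hs : s ∈ M.running
    · simp only [Set.indicator_of_mem hs, add_assoc]
      exact le_self_add
    obtain ⟨I, hI⟩ := not_forall_not.1 hs
    by_cases hG : I ∈ G
    · by_cases hG' : I ∈ G'
      · have hd := one_le_two_mul_gap_of_mem_goodIndices hk hj hT hTn hB hG hG'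
        have hds : d s = PMF.gap (A.sampler.run (hardInstance k n n) I T)
            (A.sampler.run (hardInstance k n j) I T) := by
          simp only [d, SamplingAlgorithm.samplerGap]
          rw [hI]
        rw [← hds] at hd
        calc p s = p s * 1 := (mul_one _).symm
          _ ≤ p s * (2 * d s) := by gcongr
          _ = 2 * (p s * d s) := by ring
          _ ≤ _ := le_add_left le_add_self
      · have hmem : s ∈ M.haltedIn G'ᶜ := ⟨I, hG', hI⟩
        rw [Set.indicator_of_mem hmem]
        exact le_add_left le_self_add
    · have hmem : s ∈ M.haltedIn Gᶜ := ⟨I, hG, hI⟩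
      rw [Set.indicator_of_mem hmem]
      exact le_add_right le_add_self
  have hsum := ENNReal.tsum_le_tsum hpoint
  rw [PMF.tsum_coe, ENNReal.tsum_add, ENNReal.tsum_add, ENNReal.tsum_add, ENNReal.tsum_mul_left,
    ← PMF.toOuterMeasure_apply, ← PMF.toOuterMeasure_apply, ← PMF.toOuterMeasure_apply] at hsum
  have hsum' := hsum.trans (add_le_add le_rfl (add_le_add h3 le_rfl))
  have hg : PMF.gap p q ≠ ∞ := ne_top_of_le_ne_top ENNReal.one_ne_top (PMF.gap_le_one _ _)
  clear hsum h3
  generalize PMF.gap p q = g at *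
  generalize p.toOuterMeasure M.running = P at *
  generalize p.toOuterMeasure (M.haltedIn Gᶜ) = e at *
  generalize q.toOuterMeasure (M.haltedIn G'ᶜ) = e' at *
  generalize ∑' s, p s * d s = x at *
  by_cases hx : x = ∞
  · simp [hx]
  have hP : P ≠ ∞ := by
    rintro rfl
    simp at hrun
  have he : e ≠ ∞ := by
    rintro rfl
    simp at h1
  have he' : e' ≠ ∞ := by
    rintro rfl
    simp at h2
  lift g to NNReal using hg
  lift P to NNReal using hP
  lift e to NNReal using he
  lift e' to NNReal using he'
  lift x to NNReal using hx
  norm_cast at hsum' hrun h1 h2 ⊢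
  rw [← NNReal.coe_le_coe] at hsum' hrun h1 h2 ⊢
  push_cast at hsum' hrun h1 h2 ⊢
  -- `1 ≤ 1/12 + 1/3 + (1/3 + g) + 2x` leaves `1/4 ≤ g + 2x`.
  linarith

theorem not_forall_hardInstance {k : ℕ} (hk : 4 ≤ k) (A : SamplingAlgorithm k) {T : ℕ}
    (hT : T ≠ 0) {B : ℝ≥0∞} (hB : 12 * B ≤ T)
    (hpre : A.preprocessing.expectedTime (hardInstance k (24 * T) (24 * T)) () ≤ B) :
    ¬ ∀ j ≤ 24 * T, 2 / 3 ≤ A.preprocessing.prob (hardInstance k (24 * T) j) ()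
      (A.goodIndices (hardInstance k (24 * T) j) B) := by
  intro h
  set n := 24 * T with hn
  set p := A.preprocessing.run (hardInstance k n n) () T with hp
  have hsum : (n : ℝ≥0∞) ≤ 12 * T :=
    calc (n : ℝ≥0∞) = ∑ j ∈ Finset.range n, 1 := by simp
      _ ≤ ∑ j ∈ Finset.range n,
          (4 * PMF.gap p (A.preprocessing.run (hardInstance k n j) () T) +
            8 * ∑' s, p s * A.samplerGap (hardInstance k n n) (hardInstance k n j) T s) :=
          Finset.sum_le_sum fun j hj => one_le_gap_add_tsum hk A (Finset.mem_range.1 hj) hT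
            (by omega) hB hpre (h n le_rfl) (h j (Finset.mem_range.1 hj).le)
      _ = 4 * ∑ j ∈ Finset.range n,
            PMF.gap p (A.preprocessing.run (hardInstance k n j) () T) +
          8 * ∑' s, p s * ∑ j ∈ Finset.range n,
            A.samplerGap (hardInstance k n n) (hardInstance k n j) T s := by
          rw [Finset.sum_add_distrib, ← Finset.mul_sum, ← Finset.mul_sum,
            ← Summable.tsum_finsetSum fun _ _ => ENNReal.summable]
          simp_rw [Finset.mul_sum]
      _ ≤ 4 * T + 8 * ∑' s, p s * T := by
          gcongr with s
          · exact A.preprocessing.sum_gap_run_le _ () (Finset.range n) (hardInstance k n)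
              (A.preprocessing.sum_gap_step_le _ _ _ (sum_gap_answer_le k n)) T
          · exact A.sum_samplerGap_le n T s
      _ = 12 * T := by
          rw [ENNReal.tsum_mul_right, PMF.tsum_coe]
          ring
  have hsum' : n ≤ 12 * T := by exact_mod_cast hsum
  omega

/-! ### Choice of parameters -/

theorem exists_forall_mul_rpow_le (C : ℝ) {γ c : ℝ} (hγ : 0 < γ) (hc : 0 < c) :
    ∃ N₁ : ℕ, ∀ N : ℕ, N₁ ≤ N → C * (N : ℝ) ^ (1 - γ) ≤ c * N := by
  have h0 : Filter.Tendsto (fun x : ℝ => C * x ^ (-γ)) Filter.atTop (nhds 0) := by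
    simpa using (tendsto_rpow_neg_atTop hγ).const_mul C
  obtain ⟨N₁, hN₁⟩ := Filter.eventually_atTop.1
    ((h0.comp tendsto_natCast_atTop_atTop).eventually_le_const hc)
  refine ⟨max N₁ 1, fun N hN => ?_⟩
  have hpos : (0 : ℝ) < N := by exact_mod_cast (le_max_right N₁ 1).trans hN
  have hle : C * (N : ℝ) ^ (-γ) ≤ c := hN₁ N ((le_max_left N₁ 1).trans hN)
  rw [sub_eq_neg_add, Real.rpow_add hpos, Real.rpow_one, ← mul_assoc]
  exact mul_le_mul_of_nonneg_right hle hpos.le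

theorem mainTheorem12 (k : ℕ) (hk : 4 ≤ k) (γ : ℝ) (hγ : 0 < γ) :
    ¬ ∃ (A : SamplingAlgorithm k) (C : ℝ) (N₀ : ℕ),
      ∀ R : ChainInstance k, N₀ ≤ R.size → R.ValuesFit → 1 ≤ R.out →
        A.preprocessing.expectedTime R () ≤ ENNReal.ofReal (C * (R.size : ℝ) ^ (1 - γ)) ∧
        2 / 3 ≤ A.preprocessing.prob R ()
          {I | ∃ W : ℝ, A.IsWUniformAt R I W ∧
            A.samplingTime R I W ≤ ENNReal.ofReal (C * (R.size : ℝ) ^ (1 - γ))} := by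
  rintro ⟨A, C, N₀, h⟩
  have hk0 : (0 : ℝ) < k := by
    have : 0 < k := by omega
    exact_mod_cast this
  -- Since `N ≤ 2kn = 48kT`, the factor `1 / (12 · 48k)` keeps the time bound below `T / 12`.
  obtain ⟨N₁, hN₁⟩ := exists_forall_mul_rpow_le C hγ (c := 1 / (576 * k)) (by positivity)
  let T := N₀ + N₁ + 1
  let n := 24 * T
  let N := (hardInstance k n n).size
  have hN : 2 * n ≤ N := le_size_hardInstance (by omega) n n
  have hNk : N ≤ k * (2 * n) := size_hardInstance_le k (by omega) n
  have hB : C * (N : ℝ) ^ (1 - γ) ≤ T / 12 :=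
    calc C * (N : ℝ) ^ (1 - γ) ≤ 1 / (576 * k) * N := hN₁ N (by omega)
      _ ≤ 1 / (576 * k) * (k * (2 * n) : ℕ) := by gcongr
      _ = T / 12 := by
          simp only [n]
          push_cast
          field_simp
          ring
  have hB' : 12 * ENNReal.ofReal (C * (N : ℝ) ^ (1 - γ)) ≤ T :=
    calc 12 * ENNReal.ofReal (C * (N : ℝ) ^ (1 - γ))
      _ ≤ ENNReal.ofReal 12 * ENNReal.ofReal (T / 12) := by
          rw [ENNReal.ofReal_ofNat]
          gcongr
      _ = T := by
          rw [← ENNReal.ofReal_mul (by norm_num), mul_div_cancel₀ _ (by norm_num),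
            ENNReal.ofReal_natCast]
  have hall : ∀ j ≤ n,
      A.preprocessing.expectedTime (hardInstance k n j) () ≤
          ENNReal.ofReal (C * (N : ℝ) ^ (1 - γ)) ∧
        2 / 3 ≤ A.preprocessing.prob (hardInstance k n j) ()
          (A.goodIndices (hardInstance k n j) (ENNReal.ofReal (C * (N : ℝ) ^ (1 - γ)))) := by
    intro j hj
    have hsize : (hardInstance k n j).size = N := size_hardInstance k n j n
    have hout : 1 ≤ (hardInstance k n j).out := by
      rcases hj.eq_or_lt with rfl | hj
      · exact one_le_out_hardInstance_self hk (by omega)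
      · exact le_trans (Nat.mul_pos (by omega) (by omega)) (sq_le_out_hardInstance hk hj)
    have hR := h (hardInstance k n j) (by omega) (valuesFit_hardInstance (by omega) (by omega) j)
      hout
    rwa [hsize] at hR
  exact not_forall_hardInstance hk A (by omega) hB' (hall n le_rfl).1 fun j hj => (hall j hj).2
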